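/- For $n\ge 2$ let $\Gamma_n$ be the set of all pairs $(\alpha,\beta)$ of positive real numbers with $$\frac n2\frac{\pi}{\sqrt\alpha}+\frac n2\frac{\pi}{\sqrt\beta}=\pi\quad(n\text{ even}),\qquad \frac{n+1}2\frac{\pi}{\sqrt\alpha}+\frac{n-1}2\frac{\pi}{\sqrt\beta}=\pi\quad(n\text{ odd}).$$ For $(\alpha,\beta)\in\Gamma_n$ let $f^n_{\alpha,\beta}$ be the normalized Fučík eigenfunction, i.e. the solution $u\in C^2[0,\pi]$ of $$-u''=\alpha u^+-\beta u^-\ \text{ in }(0,\pi),\qquad u(0)=u(\pi)=0,$$ with $u'(0)>0$ and $\sup_{[0,\pi]}|u|=1$, where $u^\pm=\max(\pm u,0)$; moreover let $f^1_{1,1}(x)=\sin x$. A Fučík system $F_{\alpha,\beta}$ is a sequence $(f^n_{\alpha(n),\beta(n)})_{n\ge1}$, where $\alpha,\beta\colon\{1,2,\dots\}\to\mathbb R$ satisfy $\alpha(1)=\beta(1)=1$ and $(\alpha(n),\beta(n))\in\Gamma_n$ for all $n\ge2$. A sequence $(\psi_n)_{n\ge1}$ in the real space $L^2(0,\pi)$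 is a Riesz basis if its linear span is dense and there are constants $m,M>0$ such that $$m\sum_{n=1}^N|a_n|^2\le\Big\|\sum_{n=1}^N a_n\psi_n\Big\|_{L^2(0,\pi)}^2\le M\sum_{n=1}^N|a_n|^2$$ for all $N\ge 1$ and all real $a_1,\dots,a_N$. Corollary. Let $F_{\alpha,\beta}$ be a Fučík system with $\alpha(n)=\beta(n)=n^2$ for every odd $n\ge1$, and let $\varepsilon,c>0$ be fixed. If $$\max\big(\sqrt{\alpha(n)},\sqrt{\beta(n)}\big)\le n+\sqrt c\,n^{(1-\varepsilon)/2}$$ for every even $n\ge2$, then $F_{\alpha,\beta}$ is a Riesz basis in $L^2(0,\pi)$. -/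

import Mathlib

noncomputable section

namespace Fucik

/-- The Lebesgue measure on the interval `(0, π)`. -/
def intervalMeasure : MeasureTheory.Measure ℝ :=
  MeasureTheory.volume.restrict (Set.Ioo 0 Real.pi)

/-- `f` restricted to `[0, π]` is a classical (`C²`) solution of the Fučík eigenvalue problem
`-u'' = α u⁺ - β u⁻` in `(0, π)`, `u(0) = u(π) = 0`, where `u⁺ = max(u, 0)`, `u⁻ = max(-u, 0)`. -/
structure IsClassicalSolution (α β : ℝ) (f : ℝ → ℝ) : Prop where
  contDiffOn : ContDiffOn ℝ 2 f (Set.Icc 0 Real.pi)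
  equation : ∀ x ∈ Set.Ioo 0 Real.pi,
    -deriv (deriv f) x = α * max (f x) 0 - β * max (-f x) 0
  left_boundary : f 0 = 0
  right_boundary : f Real.pi = 0

/-- The Fučík curve `Γ_n`, used for `n ≥ 2`: for even `n` there are `n / 2` positive and `n / 2`
negative bumps, for odd `n` there are `(n + 1) / 2` positive and `(n - 1) / 2` negative bumps. -/
def curve (n : ℕ) : Set (ℝ × ℝ) :=
  {p | 0 < p.1 ∧ 0 < p.2 ∧
    (Even n →
      (n : ℝ) / 2 * (Real.pi / √p.1) + (n : ℝ) / 2 * (Real.pi / √p.2) = Real.pi) ∧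
    (Odd n →
      ((n : ℝ) + 1) / 2 * (Real.pi / √p.1) + ((n : ℝ) - 1) / 2 * (Real.pi / √p.2) = Real.pi)}

/-- `f` is, on `[0, π]`, the normalized Fučík eigenfunction for the parameters `(α, β)`: the
classical solution with `f'(0) > 0` (one-sided derivative) and `sup_{[0, π]} |f| = 1`. -/
structure IsNormalizedEigenfunction (α β : ℝ) (f : ℝ → ℝ) : Prop where
  solution : IsClassicalSolution α β f
  deriv_zero_pos : 0 < derivWithin f (Set.Icc 0 Real.pi) 0
  sup_norm : IsLUB ((fun x => |f x|) '' Set.Icc 0 Real.pi) 1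

/-- `F 1, F 2, F 3, …` is the Fučík system for the maps `α, β : {1, 2, …} → ℝ`.
The values at the index `0`, and of the functions `F n` outside `[0, π]`, play no role. -/
structure IsFucikSystem (α β : ℕ → ℝ) (F : ℕ → ℝ → ℝ) : Prop where
  alpha_one : α 1 = 1
  beta_one : β 1 = 1
  mem_curve : ∀ n, 2 ≤ n → (α n, β n) ∈ curve n
  first : ∀ x ∈ Set.Icc 0 Real.pi, F 1 x = Real.sin x
  eigenfunction : ∀ n, 2 ≤ n → IsNormalizedEigenfunction (α n) (β n) (F n)

/-- A sequence in a real normed space is a Riesz basis if it is complete (its linear span is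
dense) and `c ∑ |aₙ|² ≤ ‖∑ aₙ ψₙ‖² ≤ C ∑ |aₙ|²` for all finite sums, with constants
`c, C > 0`. -/
def IsRieszBasis {E : Type*} [NormedAddCommGroup E] [NormedSpace ℝ E] (ψ : ℕ → E) : Prop :=
  (Submodule.span ℝ (Set.range ψ)).topologicalClosure = ⊤ ∧
    ∃ c C : ℝ, 0 < c ∧ 0 < C ∧ ∀ (N : ℕ) (a : ℕ → ℝ),
      c * ∑ n ∈ Finset.range N, |a n| ^ 2 ≤ ‖∑ n ∈ Finset.range N, a n • ψ n‖ ^ 2 ∧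
      ‖∑ n ∈ Finset.range N, a n • ψ n‖ ^ 2 ≤ C * ∑ n ∈ Finset.range N, |a n| ^ 2

/-- The functions `ψ 0, ψ 1, …` belong to `L²(0, π)` and their classes form a Riesz basis. -/
def IsRieszBasisL2 (ψ : ℕ → ℝ → ℝ) : Prop :=
  ∃ h : ∀ n, MeasureTheory.MemLp (ψ n) 2 intervalMeasure,
    IsRieszBasis fun n => (h n).toLp (ψ n)

end Fucik

end

/-!
The proof compares the Fučík system with the sine basis `eₙ = √(2/π) sin((n+1)x)` of `L²(0, π)`.

For even `n = 2m` the eigenfunction is completely explicit: Cauchy data determine solutions of the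
Fučík equation (`IsFucikPair.eqOn`), so on `[0, π]` it consists of `m` copies of one positive and
one negative sine arch (`IsArchPattern`). Two consequences carry the argument.

* The distance in the supremum norm from the eigenfunction to `sin(n x)` is at most
  `(2 + π) (max(√α, √β) - n) / n` (`IsArchPattern.abs_sub_sin_le`). Under the growth hypothesis
  its square is `O(n^{-1-ε})`, so the system is quadratically close to the sine basis.
* The eigenfunction has period `2π / n`, hence is orthogonal to `sin(2j x)` for `0 < 2j < n`
  (`IsArchPattern.integral_mul_sin_eq_zero`), whereas its coefficient with respect to `sin(n x)` is
  positive (`IsArchPattern.integral_mul_sin_pos`). As the members with odd index are the sines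
  themselves, the infinite matrix of sine coefficients is triangular on the even indices with
  nonzero diagonal, and the system is `ω`-linearly independent (`eq_zero_of_hasSum_triangular`).

Bari's theorem (`isRieszBasis_of_quadratically_close`) concludes: the operator `T` mapping `eₙ` to
the `n`-th (rescaled) member of the system is the identity plus a Hilbert–Schmidt operator, it is
injective by `ω`-independence, and therefore invertible by the Fredholm alternative. No smallness of
the constant `c` is needed.
-/

/-! ### Sequences quadratically close to an orthonormal basis -/

section Hilbert

open Filter Topology
open scoped InnerProductSpace

variable {H : Type*} [NormedAddCommGroup H] [InnerProductSpace ℝ H]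

theorem Fucik.IsRieszBasis.of_smul {ψ : ℕ → H} {s : ℝ} (hs : s ≠ 0)
    (h : Fucik.IsRieszBasis fun n => s • ψ n) : Fucik.IsRieszBasis ψ := by
  obtain ⟨hd, c, C, hc, hC, hb⟩ := h
  have hs2 : 0 < s ^ 2 := by positivity
  refine ⟨?_, c / s ^ 2, C / s ^ 2, by positivity, by positivity, fun N a => ?_⟩
  · have hle : Submodule.span ℝ (Set.range fun n => s • ψ n) ≤
        Submodule.span ℝ (Set.range ψ) := by
      rw [Submodule.span_le]
      rintro _ ⟨n, rfl⟩
      exact Submodule.smul_mem _ _ (Submodule.subset_span ⟨n, rfl⟩)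
    exact top_le_iff.mp (hd ▸ Submodule.topologicalClosure_mono hle)
  · have hsum : ∑ n ∈ Finset.range N, a n • s • ψ n = s • ∑ n ∈ Finset.range N, a n • ψ n := by
      rw [Finset.smul_sum]
      exact Finset.sum_congr rfl fun n _ => smul_comm _ _ _
    have hn : ‖∑ n ∈ Finset.range N, a n • s • ψ n‖ ^ 2 =
        s ^ 2 * ‖∑ n ∈ Finset.range N, a n • ψ n‖ ^ 2 := by
      rw [hsum, norm_smul, mul_pow, Real.norm_eq_abs, sq_abs]
    obtain ⟨h1, h2⟩ := hb N a
    rw [hn] at h1 h2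
    constructor
    · rw [div_mul_eq_mul_div, div_le_iff₀ hs2]
      linarith
    · rw [div_mul_eq_mul_div, le_div_iff₀ hs2]
      linarith

/-- Cauchy–Schwarz and Bessel: the finite-rank operators `x ↦ ∑ ⟪eₙ, x⟫ vₙ` are bounded by
the Hilbert–Schmidt norm. -/
theorem norm_sum_smulRight_le {e : ℕ → H} (he : Orthonormal ℝ e) (v : ℕ → H) (s : Finset ℕ) :
    ‖∑ n ∈ s, (innerSL ℝ (e n)).smulRight (v n)‖ ≤ √(∑ n ∈ s, ‖v n‖ ^ 2) := by
  refine ContinuousLinearMap.opNorm_le_bound _ (Real.sqrt_nonneg _) fun x => ?_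
  have h1 : (∑ n ∈ s, (innerSL ℝ (e n)).smulRight (v n)) x = ∑ n ∈ s, ⟪e n, x⟫_ℝ • v n := by
    simp
  rw [h1]
  calc ‖∑ n ∈ s, ⟪e n, x⟫_ℝ • v n‖ ≤ ∑ n ∈ s, ‖⟪e n, x⟫_ℝ‖ * ‖v n‖ := by
        refine (norm_sum_le _ _).trans_eq ?_
        simp [norm_smul]
    _ ≤ √(∑ n ∈ s, ‖⟪e n, x⟫_ℝ‖ ^ 2) * √(∑ n ∈ s, ‖v n‖ ^ 2) :=
        Real.sum_mul_le_sqrt_mul_sqrt _ _ _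
    _ ≤ ‖x‖ * √(∑ n ∈ s, ‖v n‖ ^ 2) := by
        gcongr
        exact Real.sqrt_le_iff.mpr ⟨norm_nonneg _, he.sum_inner_products_le x⟩
    _ = _ := mul_comm _ _

variable [CompleteSpace H]

theorem summable_smulRight_of_summable_sq {e : ℕ → H} (he : Orthonormal ℝ e) {v : ℕ → H}
    (hv : Summable fun n => ‖v n‖ ^ 2) :
    Summable fun n => (innerSL ℝ (e n)).smulRight (v n) := by
  rw [summable_iff_vanishing_norm] at hv ⊢
  intro ε hε
  obtain ⟨s, hs⟩ := hv (ε ^ 2) (by positivity)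
  refine ⟨s, fun t ht => (norm_sum_smulRight_le he v t).trans_lt ?_⟩
  rw [Real.sqrt_lt' hε]
  exact (le_abs_self _).trans_lt (hs t ht)

/-- The Hilbert–Schmidt operator `x ↦ ∑ ⟪eₙ, x⟫ vₙ` is compact. -/
theorem isCompactOperator_tsum_smulRight {e : ℕ → H} (he : Orthonormal ℝ e) {v : ℕ → H}
    (hv : Summable fun n => ‖v n‖ ^ 2) :
    IsCompactOperator (∑' n, (innerSL ℝ (e n)).smulRight (v n) : H →L[ℝ] H) := by
  refine isCompactOperator_of_tendsto (summable_smulRight_of_summable_sq he hv).hasSum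
    (Eventually.of_forall fun s => ?_)
  refine (compactOperator (RingHom.id ℝ) H H).sum_mem fun n _ => ?_
  -- each summand factors through the locally compact space `ℝ`
  exact ((isCompactOperator_id_iff_locallyCompactSpace.mpr
    (inferInstance : LocallyCompactSpace ℝ)).comp_clm (innerSL ℝ (e n))).clm_comp
    (ContinuousLinearMap.toSpanSingleton ℝ (v n))

/-- **Bari's theorem**: a sequence quadratically close to a Hilbert basis `e` is a Riesz basis as
soon as it is `ω`-linearly independent (here with square summable coefficients `⟪eₙ, x⟫`). -/
theorem isRieszBasis_of_quadratically_close (e : HilbertBasis ℕ ℝ H) {ψ : ℕ → H}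
    (hs : Summable fun n => ‖ψ n - e n‖ ^ 2)
    (hinj : ∀ x : H, HasSum (fun n => ⟪e n, x⟫_ℝ • ψ n) 0 → x = 0) :
    Fucik.IsRieszBasis ψ := by
  set K : H →L[ℝ] H := ∑' n, (innerSL ℝ (e n)).smulRight (ψ n - e n) with hK
  have hKc : IsCompactOperator K := isCompactOperator_tsum_smulRight e.orthonormal hs
  have hKx (x : H) : HasSum (fun n => ⟪e n, x⟫_ℝ • (ψ n - e n)) (K x) := by
    have h := (summable_smulRight_of_summable_sq e.orthonormal hs).hasSum.mapL
      (ContinuousLinearMap.apply ℝ H x)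
    simpa using h
  have hTx (x : H) : HasSum (fun n => ⟪e n, x⟫_ℝ • ψ n) (x + K x) := by
    convert (e.hasSum_repr x).add (hKx x) using 2 with n
    rw [e.repr_apply_apply, ← smul_add, add_sub_cancel]
  have hnot : ¬ Module.End.HasEigenvalue (K : Module.End ℝ H) (-1) := by
    intro h
    obtain ⟨x, hx⟩ := h.exists_hasEigenvector
    refine hx.2 (hinj x ?_)
    have h1 : K x = (-1 : ℝ) • x := hx.apply_eq_smul
    simpa [h1] using hTx x
  have hres := (hKc.hasEigenvalue_or_mem_resolventSet (μ := (-1 : ℝ)) (by norm_num)).resolve_left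
    hnot
  rw [spectrum.mem_resolventSet_iff] at hres
  obtain ⟨u, hu⟩ := hres
  set T : H ≃L[ℝ] H := ContinuousLinearEquiv.unitsEquiv ℝ H (-u) with hT
  have hTapp (x : H) : T x = x + K x := by
    have : (T x) = -((u : H →L[ℝ] H) x) := by simp [hT]
    rw [this, hu]
    simp [Algebra.algebraMap_eq_smul_one, add_comm]
  have hTe (k : ℕ) : T (e k) = ψ k := by
    rw [hTapp]
    refine (hTx (e k)).unique ?_
    have := hasSum_single (f := fun n => ⟪e n, e k⟫_ℝ • ψ n) k fun n hn => by
      simp [e.orthonormal.inner_eq_zero hn]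
    simpa [e.orthonormal.1 k] using this
  refine ⟨?_, ?_⟩
  · have hr : Set.range ψ = T '' Set.range e := by
      rw [← Set.range_comp]
      exact congrArg _ (funext fun k => (hTe k).symm)
    have hspan : (Submodule.span ℝ (Set.range ψ) : Set H) =
        T '' (Submodule.span ℝ (Set.range e) : Set H) := by
      rw [hr]
      exact congrArg _ (Submodule.map_span (T : H →ₗ[ℝ] H) (Set.range e)).symm
    rw [← Submodule.dense_iff_topologicalClosure_eq_top, hspan]
    exact T.surjective.denseRange.dense_image T.continuous
      (Submodule.dense_iff_topologicalClosure_eq_top.mpr e.dense_span)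
  · have hnorm (N : ℕ) (a : ℕ → ℝ) :
        ‖∑ n ∈ Finset.range N, a n • e n‖ ^ 2 = ∑ n ∈ Finset.range N, |a n| ^ 2 := by
      rw [← real_inner_self_eq_norm_sq, e.orthonormal.inner_sum]
      simp [sq]
    have hTsum (N : ℕ) (a : ℕ → ℝ) :
        ∑ n ∈ Finset.range N, a n • ψ n = T (∑ n ∈ Finset.range N, a n • e n) := by
      simp [hTe]
    set M := ‖(T : H →L[ℝ] H)‖ + 1
    set M' := ‖(T.symm : H →L[ℝ] H)‖ + 1
    have hM : 0 < M := by positivity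
    have hM' : 0 < M' := by positivity
    refine ⟨(M' ^ 2)⁻¹, M ^ 2, by positivity, by positivity, fun N a => ?_⟩
    rw [← hnorm, hTsum]
    set y := ∑ n ∈ Finset.range N, a n • e n
    constructor
    · rw [inv_mul_le_iff₀ (by positivity), ← mul_pow]
      gcongr
      calc ‖y‖ = ‖(T.symm : H →L[ℝ] H) (T y)‖ := by simp
        _ ≤ ‖(T.symm : H →L[ℝ] H)‖ * ‖T y‖ := ContinuousLinearMap.le_opNorm _ _
        _ ≤ M' * ‖T y‖ := by gcongr; simp [M']
    · rw [← mul_pow]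
      gcongr
      calc ‖T y‖ ≤ ‖(T : H →L[ℝ] H)‖ * ‖y‖ := (T : H →L[ℝ] H).le_opNorm y
        _ ≤ M * ‖y‖ := by gcongr; simp [M]

end Hilbert

/-! ### The sine basis of `L²(0, π)` -/

section SineBasis

open MeasureTheory Set
open scoped InnerProductSpace Real

instance : IsFiniteMeasure Fucik.intervalMeasure := by
  unfold Fucik.intervalMeasure
  infer_instance

theorem integral_intervalMeasure (g : ℝ → ℝ) :
    ∫ x, g x ∂Fucik.intervalMeasure = ∫ x in 0..π, g x := by
  rw [Fucik.intervalMeasure, intervalIntegral.integral_of_le Real.pi_pos.le,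
    integral_Ioc_eq_integral_Ioo]

theorem memLp_intervalMeasure_of_continuousOn {g : ℝ → ℝ} (hg : ContinuousOn g (Icc 0 π)) :
    MemLp g 2 Fucik.intervalMeasure := by
  obtain ⟨C, hC⟩ := isCompact_Icc.exists_bound_of_continuousOn hg
  refine MemLp.of_bound
    ((hg.mono Ioo_subset_Icc_self).aestronglyMeasurable measurableSet_Ioo) C ?_
  exact (ae_restrict_mem measurableSet_Ioo).mono fun x hx => hC x (Ioo_subset_Icc_self hx)

theorem inner_toLp_intervalMeasure {g h : ℝ → ℝ} (hg : MemLp g 2 Fucik.intervalMeasure)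
    (hh : MemLp h 2 Fucik.intervalMeasure) :
    ⟪hg.toLp g, hh.toLp h⟫_ℝ = ∫ x in 0..π, g x * h x := by
  rw [← integral_intervalMeasure, L2.inner_def]
  refine integral_congr_ae ?_
  filter_upwards [hg.coeFn_toLp, hh.coeFn_toLp] with x h1 h2
  simp [h1, h2, mul_comm]

theorem sub_mul_integral_sin_mul_sin (a b X : ℝ) :
    (a ^ 2 - b ^ 2) * ∫ x in 0..X, Real.sin (a * x) * Real.sin (b * x) =
      b * Real.sin (a * X) * Real.cos (b * X) - a * Real.cos (a * X) * Real.sin (b * X) := by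
  have hd (x : ℝ) : HasDerivAt
      (fun x => b * Real.sin (a * x) * Real.cos (b * x) - a * Real.cos (a * x) * Real.sin (b * x))
      ((a ^ 2 - b ^ 2) * (Real.sin (a * x) * Real.sin (b * x))) x := by
    have h1 : HasDerivAt (fun x => a * x) a x := by simpa using (hasDerivAt_id x).const_mul a
    have h2 : HasDerivAt (fun x => b * x) b x := by simpa using (hasDerivAt_id x).const_mul b
    refine (((h1.sin.const_mul b).mul h2.cos).sub ((h1.cos.const_mul a).mul h2.sin)).congr_deriv ?_
    ring
  rw [← intervalIntegral.integral_const_mul,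
    intervalIntegral.integral_eq_sub_of_hasDerivAt (fun x _ => hd x)]
  · simp
  · exact Continuous.intervalIntegrable (by fun_prop) _ _

theorem integral_sin_nat_mul_sin_nat_of_ne {j k : ℕ} (hjk : j ≠ k) :
    ∫ x in 0..π, Real.sin (j * x) * Real.sin (k * x) = 0 := by
  have h := sub_mul_integral_sin_mul_sin j k π
  rw [Real.sin_nat_mul_pi, Real.sin_nat_mul_pi] at h
  have hne : (j : ℝ) ^ 2 - (k : ℝ) ^ 2 ≠ 0 := by
    rw [sub_ne_zero]
    intro h2
    exact hjk (by exact_mod_cast (sq_eq_sq₀ j.cast_nonneg k.cast_nonneg).1 h2)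
  simpa [hne] using h

theorem integral_sin_nat_sq {k : ℕ} (hk : k ≠ 0) :
    ∫ x in 0..π, Real.sin (k * x) * Real.sin (k * x) = π / 2 := by
  have hk' : (k : ℝ) ≠ 0 := by exact_mod_cast hk
  have h : ∫ x in 0..π, Real.sin (k * x) * Real.sin (k * x) =
      ∫ x in 0..π, (fun y => Real.sin y ^ 2) (k * x) := by simp [sq]
  rw [h, intervalIntegral.integral_comp_mul_left (fun y => Real.sin y ^ 2) hk', integral_sin_sq]
  simp [Real.sin_nat_mul_pi]
  field_simp

/-- The normalized sine functions `√(2/π) sin((n+1)x)`, as elements of `L²(0, π)`. -/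
noncomputable def sineL2 (n : ℕ) : Lp ℝ 2 Fucik.intervalMeasure :=
  (memLp_intervalMeasure_of_continuousOn (g := fun x => √(2 / π) * Real.sin ((n + 1 : ℕ) * x))
    (by fun_prop)).toLp _

theorem inner_sineL2_toLp {g : ℝ → ℝ} (hg : MemLp g 2 Fucik.intervalMeasure) (n : ℕ) :
    ⟪sineL2 n, hg.toLp g⟫_ℝ = √(2 / π) * ∫ x in 0..π, g x * Real.sin ((n + 1 : ℕ) * x) := by
  rw [sineL2, inner_toLp_intervalMeasure, ← intervalIntegral.integral_const_mul]
  exact intervalIntegral.integral_congr fun x _ => by ring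

theorem orthonormal_sineL2 : Orthonormal ℝ sineL2 := by
  have hπ := Real.pi_pos
  rw [orthonormal_iff_ite]
  intro i j
  rw [show sineL2 j = MemLp.toLp _ _ from rfl, inner_sineL2_toLp]
  have h : ∀ x : ℝ, √(2 / π) * Real.sin ((j + 1 : ℕ) * x) * Real.sin ((i + 1 : ℕ) * x) =
      √(2 / π) * (Real.sin ((j + 1 : ℕ) * x) * Real.sin ((i + 1 : ℕ) * x)) := fun x => by ring
  simp_rw [h]
  rw [intervalIntegral.integral_const_mul, ← mul_assoc, Real.mul_self_sqrt (by positivity)]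
  split_ifs with hij
  · rw [hij, integral_sin_nat_sq (Nat.succ_ne_zero j)]
    field_simp
  · rw [integral_sin_nat_mul_sin_nat_of_ne (by omega), mul_zero]

/-- Completeness of the sines: the odd extension to `(-π, π)` of a function orthogonal to all the
sines has vanishing Fourier coefficients. -/
theorem ae_eq_zero_of_integral_sin_eq_zero {g : ℝ → ℝ} (hg : MemLp g 2 Fucik.intervalMeasure)
    (h0 : ∀ n : ℕ, ∫ x in 0..π, g x * Real.sin ((n + 1 : ℕ) * x) = 0) :
    g =ᵐ[Fucik.intervalMeasure] 0 := by
  have hπ := Real.pi_pos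
  have hab : -π < π := by linarith
  set g₀ : ℝ → ℂ := (Ioo 0 π).indicator fun x => (g x : ℂ) with hg₀
  have hg₀L : MemLp g₀ 2 volume := (memLp_indicator_iff_restrict measurableSet_Ioo).2 hg.ofReal
  have hneg : MemLp (fun x => g₀ (-x)) 2 volume :=
    hg₀L.comp_measurePreserving (Measure.measurePreserving_neg volume)
  set G : ℝ → ℂ := fun x => g₀ x - g₀ (-x) with hG
  have hGL : MemLp G 2 (volume.restrict (Ioc (-π) π)) := (hg₀L.sub hneg).restrict _
  have hsub : Ioo 0 π ⊆ Ioc (-π) π := fun x hx => ⟨by linarith [hx.1], hx.2.le⟩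
  have hg₀I : IntervalIntegrable g₀ volume (-π) π := by
    rw [intervalIntegrable_iff, uIoc_of_le hab.le]
    exact (hg₀L.restrict _).integrable (by norm_num)
  have hsin (k : ℤ) : ∫ x in 0..π, g x * Real.sin (k * x) = 0 := by
    obtain ⟨n, rfl | rfl⟩ := k.eq_nat_or_neg
    · cases n with
      | zero => simp
      | succ n => simpa using h0 n
    · cases n with
      | zero => simp
      | succ n => simpa [-neg_add_rev] using h0 n
  have hcoeff (k : ℤ) : fourierCoeffOn hab G k = 0 := by
    have he (x : ℝ) : fourier (-k) (x : AddCircle (π - -π)) =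
        Complex.exp (-(k * x : ℝ) * Complex.I) := by
      rw [fourier_coe_apply]
      congr 1
      push_cast
      field_simp
      ring
    have hcont : Continuous fun x : ℝ => Complex.exp (-(k * x : ℝ) * Complex.I) := by fun_prop
    have hcont' : Continuous fun x : ℝ => Complex.exp ((k * x : ℝ) * Complex.I) := by fun_prop
    have hg₀I' : IntervalIntegrable (fun x => g₀ (-x)) volume (-π) π := by
      rw [intervalIntegrable_iff, uIoc_of_le hab.le]
      exact (hneg.restrict _).integrable (by norm_num)
    have hflip : ∫ x in (-π)..π, Complex.exp (-(k * x : ℝ) * Complex.I) * g₀ (-x) =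
        ∫ x in (-π)..π, Complex.exp ((k * x : ℝ) * Complex.I) * g₀ x := by
      have h := intervalIntegral.integral_comp_neg (a := -π) (b := π)
        (fun x => Complex.exp ((k * x : ℝ) * Complex.I) * g₀ x)
      rw [neg_neg] at h
      rw [← h]
      simp
    have hint : ∫ x in (-π)..π, Complex.exp (-(k * x : ℝ) * Complex.I) * G x = 0 := by
      simp_rw [hG, mul_sub]
      rw [intervalIntegral.integral_sub (hg₀I.continuousOn_mul hcont.continuousOn)
        (hg₀I'.continuousOn_mul hcont.continuousOn), hflip,
        ← intervalIntegral.integral_sub (hg₀I.continuousOn_mul hcont.continuousOn)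
        (hg₀I.continuousOn_mul hcont'.continuousOn)]
      have h1 (x : ℝ) : Complex.exp (-(k * x : ℝ) * Complex.I) * g₀ x -
          Complex.exp ((k * x : ℝ) * Complex.I) * g₀ x =
          (Ioo 0 π).indicator
            (fun x => -2 * Complex.I * ((g x * Real.sin (k * x) : ℝ) : ℂ)) x := by
        by_cases hx : x ∈ Ioo 0 π
        · simp only [hg₀, indicator_of_mem hx]
          push_cast
          rw [Complex.sin, ← sub_mul]
          ring_nf
          simp only [Complex.I_sq]
          ring
        · simp [hg₀, hx]
      simp_rw [h1]
      rw [intervalIntegral.integral_of_le hab.le, setIntegral_indicator measurableSet_Ioo,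
        inter_eq_right.2 hsub, integral_const_mul,
        integral_complex_ofReal, ← integral_Ioc_eq_integral_Ioo, ← intervalIntegral.integral_of_le hπ.le,
        hsin k]
      simp
    rw [fourierCoeffOn_eq_integral]
    simp_rw [he, smul_eq_mul]
    rw [hint, smul_zero]
  have hpars := hasSum_sq_fourierCoeffOn hab hGL
  simp only [hcoeff] at hpars
  have hzero : ∫ x in (-π)..π, ‖G x‖ ^ 2 = 0 := by
    have h1 : (π - -π)⁻¹ • ∫ x in (-π)..π, ‖G x‖ ^ 2 = 0 :=
      hpars.unique (by simp)
    exact (smul_eq_zero.1 h1).resolve_left (by positivity)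
  rw [intervalIntegral.integral_of_le hab.le,
    integral_eq_zero_iff_of_nonneg (fun x => by positivity)
      (hGL.integrable_norm_pow (by norm_num))] at hzero
  have hle : Fucik.intervalMeasure ≤ volume.restrict (Ioc (-π) π) :=
    Measure.restrict_mono hsub le_rfl
  filter_upwards [ae_mono hle hzero, ae_restrict_mem measurableSet_Ioo] with x hx hxI
  have hx' : -x ∉ Ioo 0 π := fun h => by linarith [h.1, hxI.1]
  simpa [hG, hg₀, hxI, hx'] using hx

/-- The sines as a Hilbert basis. -/
noncomputable def sineBasis : HilbertBasis ℕ ℝ (Lp ℝ 2 Fucik.intervalMeasure) :=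
  HilbertBasis.mkOfOrthogonalEqBot orthonormal_sineL2 <| by
    have hπ := Real.pi_pos
    rw [Submodule.eq_bot_iff]
    intro f hf
    rw [Submodule.mem_orthogonal] at hf
    rw [Lp.eq_zero_iff_ae_eq_zero]
    refine ae_eq_zero_of_integral_sin_eq_zero (Lp.memLp f) fun n => ?_
    have h := hf _ (Submodule.subset_span (mem_range_self n))
    rw [← Lp.toLp_coeFn f (Lp.memLp f), inner_sineL2_toLp] at h
    exact (mul_eq_zero.1 h).resolve_left (by positivity)

theorem coe_sineBasis : ⇑sineBasis = sineL2 :=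
  HilbertBasis.coe_mkOfOrthogonalEqBot _ _

end SineBasis

/-! ### Solutions of the Fučík equation -/

section Equation

open Set
open scoped Real

/-- `u` solves `-u'' = α u⁺ - β u⁻` on `[s, t]` with derivative `w`; both derivatives are one-sided
at the end points. -/
structure IsFucikPair (α β : ℝ) (u w : ℝ → ℝ) (s t : ℝ) : Prop where
  deriv_fst : ∀ x ∈ Icc s t, HasDerivWithinAt u (w x) (Icc s t) x
  deriv_snd : ∀ x ∈ Icc s t,
    HasDerivWithinAt w (-(α * max (u x) 0 - β * max (-u x) 0)) (Icc s t) x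

namespace IsFucikPair

variable {α β : ℝ} {u w v z : ℝ → ℝ} {s t s' t' : ℝ}

theorem mono (h : IsFucikPair α β u w s t) (hs : s ≤ s') (ht : t' ≤ t) :
    IsFucikPair α β u w s' t' where
  deriv_fst x hx := (h.deriv_fst x (Icc_subset_Icc hs ht hx)).mono (Icc_subset_Icc hs ht)
  deriv_snd x hx := (h.deriv_snd x (Icc_subset_Icc hs ht hx)).mono (Icc_subset_Icc hs ht)

theorem neg (h : IsFucikPair α β u w s t) : IsFucikPair β α (-u) (-w) s t where
  deriv_fst x hx := (h.deriv_fst x hx).neg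
  deriv_snd x hx := by
    refine (h.deriv_snd x hx).neg.congr_deriv ?_
    simp only [Pi.neg_apply, neg_neg]
    ring

/-- The equation has a Lipschitz right-hand side, so Cauchy data determine the solution. -/
theorem eqOn (h : IsFucikPair α β u w s t) (h' : IsFucikPair α β v z s t)
    (hu : u s = v s) (hw : w s = z s) : ∀ x ∈ Icc s t, u x = v x ∧ w x = z x := by
  have hcont {u w : ℝ → ℝ} (h : IsFucikPair α β u w s t) :
      ContinuousOn (fun x => (u x, w x)) (Icc s t) := fun x hx =>
    ((h.deriv_fst x hx).continuousWithinAt).prodMk (h.deriv_snd x hx).continuousWithinAt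
  have hder {u w : ℝ → ℝ} (h : IsFucikPair α β u w s t) (x : ℝ) (hx : x ∈ Ico s t) :
      HasDerivWithinAt (fun x => (u x, w x))
        (w x, -(α * max (u x) 0 - β * max (-u x) 0)) (Ici x) x :=
    ((h.deriv_fst x (Ico_subset_Icc_self hx)).prodMk
      (h.deriv_snd x (Ico_subset_Icc_self hx))).mono_of_mem_nhdsWithin (Icc_mem_nhdsGE_of_mem hx)
  have hlip : LipschitzWith (max 1 (‖α‖₊ + ‖β‖₊))
      (fun p : ℝ × ℝ => (p.2, -(α * max p.1 0 - β * max (-p.1) 0))) := by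
    refine LipschitzWith.of_dist_le_mul fun p q => ?_
    have h1 : |p.1 - q.1| ≤ dist p q := by
      rw [← Real.dist_eq]; exact le_max_left _ _
    have h2 : |p.2 - q.2| ≤ dist p q := by
      rw [← Real.dist_eq]; exact le_max_right _ _
    rw [Prod.dist_eq, NNReal.coe_max]
    push_cast
    have hd := dist_nonneg (x := p) (y := q)
    refine max_le ?_ ?_
    · rw [Real.dist_eq]
      calc |p.2 - q.2| ≤ 1 * dist p q := by linarith
        _ ≤ _ := by gcongr; exact le_max_left _ _
    · rw [Real.dist_eq]
      have e1 : |max p.1 0 - max q.1 0| ≤ |p.1 - q.1| := abs_max_sub_max_le_abs _ _ _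
      have e2 : |max (-p.1) 0 - max (-q.1) 0| ≤ |p.1 - q.1| := by
        refine (abs_max_sub_max_le_abs _ _ _).trans_eq ?_
        rw [← abs_neg]; congr 1; ring
      calc |-(α * max p.1 0 - β * max (-p.1) 0) - -(α * max q.1 0 - β * max (-q.1) 0)|
          = |β * (max (-p.1) 0 - max (-q.1) 0) - α * (max p.1 0 - max q.1 0)| := by
            congr 1; ring
        _ ≤ |β| * |max (-p.1) 0 - max (-q.1) 0| + |α| * |max p.1 0 - max q.1 0| := by
            rw [← abs_mul, ← abs_mul]; exact abs_sub _ _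
        _ ≤ |β| * dist p q + |α| * dist p q := by
            gcongr
            · exact e2.trans h1
            · exact e1.trans h1
        _ = (|α| + |β|) * dist p q := by ring
        _ ≤ _ := by gcongr; exact le_max_right _ _
  have key := ODE_solution_unique_of_mem_Icc_right (s := fun _ => univ)
    (v := fun _ p => (p.2, -(α * max p.1 0 - β * max (-p.1) 0)))
    (fun _ _ => hlip.lipschitzOnWith) (hcont h) (hder h) (fun _ _ => mem_univ _)
    (hcont h') (hder h') (fun _ _ => mem_univ _) (by simp [hu, hw])
  intro x hx
  simpa using key hx

theorem sin_bump {a d : ℝ} (ha : 0 < a) (hd : 0 ≤ d) (β s : ℝ) :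
    IsFucikPair (a ^ 2) β (fun x => d / a * Real.sin (a * (x - s)))
      (fun x => d * Real.cos (a * (x - s))) s (s + π / a) := by
  have hlin (x : ℝ) : HasDerivAt (fun x => a * (x - s)) a x := by
    simpa using ((hasDerivAt_id x).sub_const s).const_mul a
  refine ⟨fun x _ => ?_, fun x hx => ?_⟩
  · refine (((hlin x).sin.const_mul (d / a)).congr_deriv ?_).hasDerivWithinAt
    field_simp
  · refine (((hlin x).cos.const_mul d).congr_deriv ?_).hasDerivWithinAt
    have h0 : 0 ≤ d / a * Real.sin (a * (x - s)) := by
      refine mul_nonneg (by positivity) (Real.sin_nonneg_of_nonneg_of_le_pi ?_ ?_)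
      · exact mul_nonneg ha.le (by linarith [hx.1])
      · rw [← le_div_iff₀' ha]; linarith [hx.2]
    rw [max_eq_left h0, max_eq_right (by linarith)]
    field_simp
    ring

theorem sin_linear {a : ℝ} (ha : a ≠ 0) (d s t : ℝ) :
    IsFucikPair (a ^ 2) (a ^ 2) (fun x => d / a * Real.sin (a * x))
      (fun x => d * Real.cos (a * x)) s t := by
  have hlin (x : ℝ) : HasDerivAt (fun x => a * x) a x := by
    simpa using (hasDerivAt_id x).const_mul a
  refine ⟨fun x _ => ?_, fun x _ => ?_⟩
  · refine (((hlin x).sin.const_mul (d / a)).congr_deriv ?_).hasDerivWithinAt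
    field_simp
  · refine (((hlin x).cos.const_mul d).congr_deriv ?_).hasDerivWithinAt
    rw [← mul_sub, max_zero_sub_max_neg_zero_eq_self]
    field_simp

/-- A solution leaving zero upwards at `s` with slope `d` is a sine arch of length `π / a`, and
arrives at zero with slope `-d`. -/
theorem eq_bump {a d : ℝ} (ha : 0 < a) (hd : 0 ≤ d) (h : IsFucikPair (a ^ 2) β u w s t)
    (hs : s ≤ s') (ht : s' + π / a ≤ t) (hu : u s' = 0) (hw : w s' = d) :
    (∀ y ∈ Icc 0 (π / a), u (s' + y) = d / a * Real.sin (a * y)) ∧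
      u (s' + π / a) = 0 ∧ w (s' + π / a) = -d := by
  have hπ : 0 < π / a := by positivity
  have key := (h.mono hs ht).eqOn (sin_bump ha hd β s') (by simp [hu]) (by simp [hw])
  refine ⟨fun y hy => ?_, ?_, ?_⟩
  · simpa using (key (s' + y) ⟨by linarith [hy.1], by linarith [hy.2]⟩).1
  · simpa [mul_div_cancel₀ _ ha.ne'] using (key (s' + π / a) ⟨by linarith, le_rfl⟩).1
  · simpa [mul_div_cancel₀ _ ha.ne'] using (key (s' + π / a) ⟨by linarith, le_rfl⟩).2

/-- A positive arch followed by a negative one, repeated: the solution is periodic. -/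
theorem eq_periodic {a b d : ℝ} (ha : 0 < a) (hb : 0 < b) (hd : 0 ≤ d)
    (h : IsFucikPair (a ^ 2) (b ^ 2) u w 0 t) (hu : u 0 = 0) (hw : w 0 = d) {m : ℕ}
    (ht : m * (π / a + π / b) ≤ t) :
    ∀ k < m, (∀ y ∈ Icc 0 (π / a), u (k * (π / a + π / b) + y) = d / a * Real.sin (a * y)) ∧
      ∀ y ∈ Icc 0 (π / b),
        u (k * (π / a + π / b) + π / a + y) = -(d / b * Real.sin (b * y)) := by
  have hπa : 0 < π / a := by positivity
  have hπb : 0 < π / b := by positivity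
  set p := π / a + π / b with hp
  have hstep : ∀ k < m, u (k * p) = 0 → w (k * p) = d →
      ((∀ y ∈ Icc 0 (π / a), u (k * p + y) = d / a * Real.sin (a * y)) ∧
      (∀ y ∈ Icc 0 (π / b), u (k * p + π / a + y) = -(d / b * Real.sin (b * y)))) ∧
      u ((k + 1 : ℕ) * p) = 0 ∧ w ((k + 1 : ℕ) * p) = d := by
    intro k hk hku hkw
    have hkp : 0 ≤ k * p := by positivity
    have hk1 : ((k + 1 : ℕ) : ℝ) * p ≤ t :=
      (mul_le_mul_of_nonneg_right (by exact_mod_cast hk) (by positivity)).trans ht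
    have hk2 : ((k + 1 : ℕ) : ℝ) * p = k * p + π / a + π / b := by push_cast; rw [hp]; ring
    rw [hk2] at hk1 ⊢
    obtain ⟨h1, h2, h3⟩ := h.eq_bump ha hd hkp (by linarith) hku hkw
    obtain ⟨h4, h5, h6⟩ := h.neg.eq_bump hb hd (s' := k * p + π / a) (by linarith) hk1
      (by simp [h2]) (by simp [h3])
    refine ⟨⟨h1, fun y hy => ?_⟩, by simpa using h5, by simpa using h6⟩
    simpa [neg_eq_iff_eq_neg] using h4 y hy
  have hzero : ∀ k ≤ m, u (k * p) = 0 ∧ w (k * p) = d := by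
    intro k
    induction k with
    | zero => intro _; simpa using ⟨hu, hw⟩
    | succ k ih => intro hk; exact (hstep k hk (ih (by omega)).1 (ih (by omega)).2).2
  exact fun k hk => (hstep k hk (hzero k hk.le).1 (hzero k hk.le).2).1

end IsFucikPair

theorem Fucik.IsClassicalSolution.isFucikPair {α β : ℝ} {f : ℝ → ℝ}
    (h : Fucik.IsClassicalSolution α β f) :
    IsFucikPair α β f (derivWithin f (Icc 0 π)) 0 π := by
  have hπ := Real.pi_pos
  have hU : UniqueDiffOn ℝ (Icc (0 : ℝ) π) := uniqueDiffOn_Icc hπ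
  have hC1 : ContDiffOn ℝ 1 (derivWithin f (Icc 0 π)) (Icc 0 π) :=
    h.contDiffOn.derivWithin hU (by norm_num)
  have hd1 : DifferentiableOn ℝ f (Icc 0 π) := h.contDiffOn.differentiableOn (by norm_num)
  have hd2 : DifferentiableOn ℝ (derivWithin f (Icc 0 π)) (Icc 0 π) :=
    hC1.differentiableOn (by norm_num)
  have heq : EqOn (derivWithin (derivWithin f (Icc 0 π)) (Icc 0 π))
      (fun x => -(α * max (f x) 0 - β * max (-f x) 0)) (Ioo 0 π) := by
    intro x hx
    have hnhds {y : ℝ} (hy : y ∈ Ioo 0 π) : Icc 0 π ∈ nhds y := Icc_mem_nhds hy.1 hy.2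
    have hev : derivWithin f (Icc 0 π) =ᶠ[nhds x] deriv f := by
      filter_upwards [Ioo_mem_nhds hx.1 hx.2] with y hy
      exact derivWithin_of_mem_nhds (hnhds hy)
    dsimp only
    rw [derivWithin_of_mem_nhds (hnhds hx), hev.deriv_eq, ← h.equation x hx, neg_neg]
  -- both sides are continuous on `[0, π]`, so the equation extends to the end points
  have heq' : EqOn (derivWithin (derivWithin f (Icc 0 π)) (Icc 0 π))
      (fun x => -(α * max (f x) 0 - β * max (-f x) 0)) (Icc 0 π) := by
    have hf := h.contDiffOn.continuousOn
    refine heq.of_subset_closure (hC1.continuousOn_derivWithin hU le_rfl) ?_ Ioo_subset_Icc_self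
      (closure_Ioo hπ.ne).ge
    fun_prop
  exact ⟨fun x hx => (hd1 x hx).hasDerivWithinAt,
    fun x hx => (hd2 x hx).hasDerivWithinAt.congr_deriv (heq' hx)⟩

end Equation

/-! ### Shape of the normalized eigenfunctions -/

section Shape

open Set
open scoped Real

/-- `f` consists, on `[0, π]`, of `m` copies of a pattern of length `π / m` made of a positive arch
`A sin(a y)` and a negative arch `-B sin(b y)`, with the larger of the amplitudes equal to `1`.
The positive arch is parametrized from its left end, the negative one backwards from its right
end. -/
structure IsArchPattern (m : ℕ) (a b A B : ℝ) (f : ℝ → ℝ) : Prop where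
  pos_left : 0 < a
  pos_right : 0 < b
  pos_count : 0 < m
  length : π / a + π / b = π / m
  amp_left_pos : 0 < A
  amp_right_pos : 0 < B
  slope : A * a = B * b
  amp_max : max A B = 1
  left_arch : ∀ k < m, ∀ y ∈ Icc 0 (π / a), f (k * (π / m) + y) = A * Real.sin (a * y)
  right_arch : ∀ k < m, ∀ y ∈ Icc 0 (π / b), f ((k + 1) * (π / m) - y) = -(B * Real.sin (b * y))

/-- Every point of `[0, π]` lies on one of the arches. -/
theorem exists_arch {m : ℕ} (hm : 0 < m) {l r : ℝ} (hr : 0 < r) (hlr : l + r = π / m)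
    {x : ℝ} (hx : x ∈ Icc 0 π) :
    ∃ k < m, (∃ y ∈ Icc 0 l, x = k * (π / m) + y) ∨ ∃ y ∈ Icc 0 r, x = (k + 1) * (π / m) - y := by
  have hm' : (0 : ℝ) < m := by exact_mod_cast hm
  have hp : 0 < π / m := by positivity
  have hmp : m * (π / m) = π := by field_simp
  rcases hx.2.eq_or_lt with rfl | hlt
  · refine ⟨m - 1, by omega, Or.inr ⟨0, ⟨le_rfl, hr.le⟩, ?_⟩⟩
    rw [Nat.cast_sub hm]
    push_cast
    linarith
  · refine ⟨⌊x / (π / m)⌋₊, ?_, ?_⟩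
    · rw [Nat.floor_lt (by have := hx.1; positivity), div_lt_iff₀ hp]
      linarith
    · set k := ⌊x / (π / m)⌋₊
      have h1 : k * (π / m) ≤ x := by
        rw [← le_div_iff₀ hp]
        exact Nat.floor_le (by have := hx.1; positivity)
      have h2 : x < (k + 1) * (π / m) := by
        rw [← div_lt_iff₀ hp]
        exact Nat.lt_floor_add_one _
      rcases le_total (x - k * (π / m)) l with h | h
      · exact Or.inl ⟨x - k * (π / m), ⟨by linarith, h⟩, by ring⟩
      · exact Or.inr ⟨(k + 1) * (π / m) - x, ⟨by linarith, by linarith⟩, by ring⟩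

theorem Fucik.IsNormalizedEigenfunction.eq_sin {a : ℝ} (ha : 1 ≤ a) {f : ℝ → ℝ}
    (h : Fucik.IsNormalizedEigenfunction (a ^ 2) (a ^ 2) f) :
    ∀ x ∈ Icc 0 π, f x = Real.sin (a * x) := by
  have hπ := Real.pi_pos
  have ha0 : 0 < a := by linarith
  set d := derivWithin f (Icc 0 π) 0 with hd
  have hd0 : 0 < d := h.deriv_zero_pos
  have key : ∀ x ∈ Icc 0 π, f x = d / a * Real.sin (a * x) := fun x hx =>
    (h.solution.isFucikPair.eqOn (IsFucikPair.sin_linear ha0.ne' d 0 π)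
      (by simp [h.solution.left_boundary]) (by simp [hd]) x hx).1
  have hda : 0 < d / a := by positivity
  have h1 : d / a ≤ 1 := by
    have hx : π / 2 / a ∈ Icc 0 π :=
      ⟨by positivity, by rw [div_le_iff₀ ha0]; nlinarith⟩
    have h2 := h.sup_norm.1 ⟨_, hx, rfl⟩
    dsimp only at h2
    rw [key _ hx, mul_div_cancel₀ _ ha0.ne', Real.sin_pi_div_two, mul_one] at h2
    exact (le_abs_self _).trans h2
  have h2 : 1 ≤ d / a := by
    refine h.sup_norm.2 ?_
    rintro _ ⟨x, hx, rfl⟩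
    dsimp only
    rw [key x hx, abs_mul, abs_of_pos hda]
    exact mul_le_of_le_one_right hda.le (Real.abs_sin_le_one _)
  intro x hx
  rw [key x hx, le_antisymm h1 h2, one_mul]

theorem Fucik.IsNormalizedEigenfunction.isArchPattern {α β : ℝ} {f : ℝ → ℝ} {m : ℕ} (hm : 0 < m)
    (hc : (α, β) ∈ Fucik.curve (2 * m)) (h : Fucik.IsNormalizedEigenfunction α β f) :
    ∃ A B, IsArchPattern m √α √β A B f := by
  obtain ⟨hα, hβ, hev, -⟩ := hc
  simp only at hα hβ hev
  have hπ := Real.pi_pos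
  have hm' : (0 : ℝ) < m := by exact_mod_cast hm
  have ha : 0 < √α := Real.sqrt_pos.2 hα
  have hb : 0 < √β := Real.sqrt_pos.2 hβ
  have hlen : π / √α + π / √β = π / m := by
    have h1 := hev (even_two_mul m)
    push_cast at h1
    rw [eq_div_iff hm'.ne']
    linarith
  set a := √α with haα
  set b := √β with hbβ
  have hαa : α = a ^ 2 := (Real.sq_sqrt hα.le).symm
  have hβb : β = b ^ 2 := (Real.sq_sqrt hβ.le).symm
  set d := derivWithin f (Icc 0 π) 0 with hd
  have hd0 : 0 < d := h.deriv_zero_pos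
  have hA : 0 < d / a := by positivity
  have hB : 0 < d / b := by positivity
  have hπa : 0 < π / a := by positivity
  have hπb : 0 < π / b := by positivity
  have hmp : m * (π / m) = π := by field_simp
  have hpair := h.solution.isFucikPair
  rw [hαa, hβb] at hpair
  have hper := hpair.eq_periodic ha hb hd0.le h.solution.left_boundary hd.symm (m := m)
    (by rw [hlen, hmp])
  rw [hlen] at hper
  have hleft : ∀ k < m, ∀ y ∈ Icc 0 (π / a), f (k * (π / m) + y) = d / a * Real.sin (a * y) :=
    fun k hk => (hper k hk).1
  have hright : ∀ k < m, ∀ y ∈ Icc 0 (π / b),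
      f ((k + 1) * (π / m) - y) = -(d / b * Real.sin (b * y)) := by
    intro k hk y hy
    have h1 := (hper k hk).2 (π / b - y) ⟨by linarith [hy.2], by linarith [hy.1]⟩
    rw [mul_sub, mul_div_cancel₀ _ hb.ne', Real.sin_pi_sub] at h1
    rw [← h1]
    congr 1
    linarith
  refine ⟨d / a, d / b, ha, hb, hm, hlen, hA, hB, by field_simp, le_antisymm ?_ ?_, hleft, hright⟩
  · have hpm : π / m ≤ π := div_le_self hπ.le (by exact_mod_cast hm)
    -- the peaks of the arches in the first period
    refine max_le ?_ ?_
    · have hy : π / a / 2 ∈ Icc 0 (π / a) := ⟨by positivity, by linarith⟩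
      have h1 := hleft 0 hm _ hy
      have h2 := h.sup_norm.1 ⟨((0 : ℕ) : ℝ) * (π / m) + π / a / 2,
        ⟨by simp; positivity, by simp; linarith⟩, rfl⟩
      dsimp only at h2
      rw [h1, ← mul_div_assoc, mul_div_cancel₀ _ ha.ne', Real.sin_pi_div_two, mul_one] at h2
      exact (le_abs_self _).trans h2
    · have hy : π / b / 2 ∈ Icc 0 (π / b) := ⟨by positivity, by linarith⟩
      have h1 := hright 0 hm _ hy
      have h2 := h.sup_norm.1 ⟨(((0 : ℕ) : ℝ) + 1) * (π / m) - π / b / 2,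
        ⟨by simp; linarith, by simp; linarith⟩, rfl⟩
      dsimp only at h2
      rw [h1, ← mul_div_assoc, mul_div_cancel₀ _ hb.ne', Real.sin_pi_div_two, mul_one, abs_neg]
        at h2
      exact (le_abs_self _).trans h2
  · refine h.sup_norm.2 ?_
    rintro _ ⟨x, hx, rfl⟩
    dsimp only
    obtain ⟨k, hk, ⟨y, hy, rfl⟩ | ⟨y, hy, rfl⟩⟩ := exists_arch hm hπb hlen hx
    · rw [hleft k hk y hy, abs_mul, abs_of_pos hA]
      exact (mul_le_of_le_one_right hA.le (Real.abs_sin_le_one _)).trans (le_max_left _ _)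
    · rw [hright k hk y hy, abs_neg, abs_mul, abs_of_pos hB]
      exact (mul_le_of_le_one_right hB.le (Real.abs_sin_le_one _)).trans (le_max_right _ _)

end Shape

/-! ### Distance to the sine functions -/

section Distance

open Set
open scoped Real

theorem abs_mul_sin_sub_sin_le {a A n y : ℝ} (hy : 0 ≤ y) :
    |A * Real.sin (a * y) - Real.sin (n * y)| ≤ |A - 1| + |a - n| * y := by
  have h1 : A * Real.sin (a * y) - Real.sin (n * y) =
      (A - 1) * Real.sin (a * y) + (Real.sin (a * y) - Real.sin (n * y)) := by ring
  rw [h1]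
  refine (abs_add_le _ _).trans (add_le_add ?_ ?_)
  · rw [abs_mul]
    exact mul_le_of_le_one_right (abs_nonneg _) (Real.abs_sin_le_one _)
  · refine (Real.abs_sin_sub_sin_le _ _).trans_eq ?_
    rw [← sub_mul, abs_mul, abs_of_nonneg hy]

/-- If `n / a + n / b = 2` and `a ≤ b`, then `η = n / a - 1 = 1 - n / b ≥ 0` controls all the
deviations of the arches from those of `sin(n x)`, and `η ≤ (b - n) / n`. -/
theorem arch_parameters_close {a b A B n : ℝ} (ha : 0 < a) (hb : 0 < b) (hn : 0 < n)
    (hab : a ≤ b) (hsum : n / a + n / b = 2) (hA : 0 < A) (hslope : A * a = B * b)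
    (hmax : max A B = 1) :
    |A - 1| ≤ 2 * ((b - n) / n) ∧ |B - 1| ≤ 2 * ((b - n) / n) ∧
      |a - n| * (π / a) ≤ π * ((b - n) / n) ∧ |b - n| * (π / b) ≤ π * ((b - n) / n) := by
  have hπ := Real.pi_pos
  have hBA : B ≤ A := le_of_mul_le_mul_right (by nlinarith) hb
  have hA1 : A = 1 := by rwa [max_eq_left hBA] at hmax
  have hB : B = a / b := by rw [hA1] at hslope; field_simp; linarith
  have hvu : n / b ≤ n / a := by gcongr
  have hη : 0 ≤ 1 - n / b := by linarith
  have hnb : n ≤ b := by rw [← div_le_one hb]; linarith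
  have han : a ≤ n := by rw [← one_le_div ha]; linarith
  have hle : 1 - n / b ≤ (b - n) / n := by
    have : 1 - n / b = (b - n) / b := by field_simp
    rw [this]
    exact div_le_div_of_nonneg_left (by linarith) hn hnb
  refine ⟨?_, ?_, ?_, ?_⟩
  · rw [hA1]; simp; linarith
  · have h1 : 1 - a / b = (a / n) * (2 * (1 - n / b)) := by
      have : 2 * (1 - n / b) = n / a - n / b := by linarith
      rw [this]; field_simp
    have h2 : a / n ≤ 1 := by rwa [div_le_one hn]
    rw [hB, abs_sub_comm, abs_of_nonneg (by rw [sub_nonneg, div_le_one hb]; exact hab), h1]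
    calc a / n * (2 * (1 - n / b)) ≤ 1 * (2 * (1 - n / b)) := by gcongr
      _ ≤ _ := by linarith
  · have h1 : |a - n| * (π / a) = π * (1 - n / b) := by
      rw [abs_of_nonpos (by linarith)]
      have : 1 - n / b = n / a - 1 := by linarith
      rw [this]; field_simp; ring
    rw [h1]; gcongr
  · have h1 : |b - n| * (π / b) = π * (1 - n / b) := by
      rw [abs_of_nonneg (by linarith)]
      field_simp
    rw [h1]; gcongr

namespace IsArchPattern

variable {m : ℕ} {a b A B : ℝ} {f : ℝ → ℝ}

theorem freq_ratio_sum (h : IsArchPattern m a b A B f) : 2 * m / a + 2 * m / b = (2 : ℝ) := by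
  have h1 := h.length
  have hm : (0 : ℝ) < m := by exact_mod_cast h.pos_count
  have ha := h.pos_left
  have hb := h.pos_right
  have hπ := Real.pi_pos
  field_simp at h1 ⊢
  linarith

theorem parameters_close (h : IsArchPattern m a b A B f) :
    |A - 1| ≤ 2 * ((max a b - 2 * m) / (2 * m)) ∧ |B - 1| ≤ 2 * ((max a b - 2 * m) / (2 * m)) ∧
      |a - 2 * m| * (π / a) ≤ π * ((max a b - 2 * m) / (2 * m)) ∧
      |b - 2 * m| * (π / b) ≤ π * ((max a b - 2 * m) / (2 * m)) := by
  have hm : (0 : ℝ) < 2 * m := by exact_mod_cast Nat.mul_pos two_pos h.pos_count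
  rcases le_total a b with hab | hab
  · rw [max_eq_right hab]
    exact arch_parameters_close h.pos_left h.pos_right hm hab h.freq_ratio_sum h.amp_left_pos
      h.slope h.amp_max
  · rw [max_eq_left hab]
    obtain ⟨h1, h2, h3, h4⟩ := arch_parameters_close h.pos_right h.pos_left hm hab
      ((add_comm _ _).trans h.freq_ratio_sum) h.amp_right_pos h.slope.symm
      ((max_comm _ _).trans h.amp_max)
    exact ⟨h2, h1, h4, h3⟩

theorem abs_sub_sin_le (h : IsArchPattern m a b A B f) {x : ℝ} (hx : x ∈ Icc 0 π) :
    |f x - Real.sin (2 * m * x)| ≤ (2 + π) * ((max a b - 2 * m) / (2 * m)) := by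
  have hm : (0 : ℝ) < m := by exact_mod_cast h.pos_count
  obtain ⟨h1, h2, h3, h4⟩ := h.parameters_close
  have hπb : 0 < π / b := div_pos Real.pi_pos h.pos_right
  obtain ⟨k, hk, ⟨y, hy, rfl⟩ | ⟨y, hy, rfl⟩⟩ := exists_arch h.pos_count hπb h.length hx
  · have e : 2 * m * (k * (π / m) + y) = 2 * m * y + k * (2 * π) := by field_simp; ring
    rw [h.left_arch k hk y hy, e, Real.sin_add_nat_mul_two_pi]
    refine (abs_mul_sin_sub_sin_le hy.1).trans ?_
    have : |a - 2 * m| * y ≤ |a - 2 * m| * (π / a) := by gcongr; exact hy.2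
    linarith
  · have e : 2 * m * ((k + 1) * (π / m) - y) = ((k + 1 : ℕ) : ℝ) * (2 * π) - 2 * m * y := by
      push_cast; field_simp
    rw [h.right_arch k hk y hy, e, Real.sin_nat_mul_two_pi_sub, ← neg_sub', abs_neg]
    refine (abs_mul_sin_sub_sin_le hy.1).trans ?_
    have : |b - 2 * m| * y ≤ |b - 2 * m| * (π / b) := by gcongr; exact hy.2
    linarith

end IsArchPattern

end Distance

/-! ### Sine coefficients of the eigenfunctions with even index -/

section Coefficients

open Set
open scoped Real

theorem integral_sin_mul_sin_pos {a n : ℝ} (ha : 0 < a) (hn : 0 < n) (hna : n / a < 2) :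
    0 < ∫ y in 0..(π / a), Real.sin (a * y) * Real.sin (n * y) := by
  have hπ := Real.pi_pos
  have hπa : 0 < π / a := by positivity
  rcases le_or_gt n a with hle | hlt
  · -- both factors are positive inside the interval
    refine intervalIntegral.intervalIntegral_pos_of_pos_on
      (Continuous.intervalIntegrable (by fun_prop) _ _) (fun y hy => ?_) hπa
    have h1 : a * y < π := by rw [← lt_div_iff₀' ha]; exact hy.2
    have h2 : n * y ≤ a * y := mul_le_mul_of_nonneg_right hle hy.1.le
    exact mul_pos (Real.sin_pos_of_pos_of_lt_pi (mul_pos ha hy.1) h1)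
      (Real.sin_pos_of_pos_of_lt_pi (mul_pos hn hy.1) (by linarith))
  · -- the integral is `a sin(nπ/a) / (a² - n²)`, where `π < nπ/a < 2π`
    have h := sub_mul_integral_sin_mul_sin a n (π / a)
    rw [mul_div_cancel₀ _ ha.ne', Real.sin_pi, Real.cos_pi] at h
    have h1 : 1 < n / a := by rwa [one_lt_div ha]
    have hs : Real.sin (n * (π / a)) < 0 := by
      have e : n * (π / a) = (n / a - 1) * π + π := by field_simp; ring
      rw [e, Real.sin_add_pi, neg_lt_zero]
      exact Real.sin_pos_of_pos_of_lt_pi (by nlinarith) (by nlinarith)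
    have hsq : a ^ 2 - n ^ 2 < 0 := by nlinarith
    have hrhs : (a ^ 2 - n ^ 2) * ∫ y in 0..(π / a), Real.sin (a * y) * Real.sin (n * y) < 0 := by
      rw [h]; nlinarith
    exact pos_of_mul_neg_right hrhs hsq.le

namespace IsArchPattern

variable {m : ℕ} {a b A B : ℝ} {f : ℝ → ℝ}

theorem apply_add_period (h : IsArchPattern m a b A B f) {k : ℕ} (hk : k < m) {y : ℝ}
    (hy : y ∈ Icc 0 (π / m)) : f (k * (π / m) + y) = f y := by
  have hlen := h.length
  rcases le_total y (π / a) with hya | hya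
  · have h0 := h.left_arch 0 h.pos_count y ⟨hy.1, hya⟩
    rw [Nat.cast_zero, zero_mul, zero_add] at h0
    rw [h.left_arch k hk y ⟨hy.1, hya⟩, h0]
  · have hz : π / m - y ∈ Icc 0 (π / b) := ⟨by linarith [hy.2], by linarith⟩
    have h0 := h.right_arch 0 h.pos_count _ hz
    have h1 := h.right_arch k hk _ hz
    rw [Nat.cast_zero, zero_add, one_mul, sub_sub_cancel] at h0
    rw [h0, ← h1]
    congr 1
    ring

theorem integral_mul_eq_sum (h : IsArchPattern m a b A B f) (hf : ContinuousOn f (Icc 0 π))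
    {g : ℝ → ℝ} (hg : Continuous g) :
    ∫ x in 0..π, f x * g x =
      ∑ k ∈ Finset.range m, ∫ y in 0..(π / m), f y * g (k * (π / m) + y) := by
  have hπ := Real.pi_pos
  have hm : (0 : ℝ) < m := by exact_mod_cast h.pos_count
  have hp : 0 < π / m := by positivity
  have hmp : m * (π / m) = π := by field_simp
  have hle {k : ℕ} (hk : k ≤ m) : k * (π / m) ≤ π := by
    calc k * (π / m) ≤ m * (π / m) := by gcongr
      _ = π := hmp
  have hsum := intervalIntegral.sum_integral_adjacent_intervals (μ := MeasureTheory.volume)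
    (f := fun x => f x * g x) (a := fun k : ℕ => k * (π / m)) (n := m) fun k hk => by
      refine ContinuousOn.intervalIntegrable ((hf.mono ?_).mul hg.continuousOn)
      rw [uIcc_of_le (by gcongr; simp)]
      exact Icc_subset_Icc (by positivity) (hle hk)
  rw [hmp, Nat.cast_zero, zero_mul] at hsum
  rw [← hsum]
  refine Finset.sum_congr rfl fun k hk => ?_
  have e : ((k + 1 : ℕ) : ℝ) * (π / m) = π / m + k * (π / m) := by push_cast; ring
  have e0 : (k : ℝ) * (π / m) = 0 + k * (π / m) := by ring
  rw [e]
  nth_rw 1 [e0]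
  rw [← intervalIntegral.integral_comp_add_right (fun x => f x * g x)]
  refine intervalIntegral.integral_congr fun y hy => ?_
  rw [uIcc_of_le hp.le] at hy
  rw [add_comm y, h.apply_add_period (Finset.mem_range.1 hk) hy]

/-- By periodicity, the sine coefficients of frequency `2j < 2m` vanish: multiplied by `2 sin(jp)`
with `p = π/m`, the sum over the periods telescopes. -/
theorem integral_mul_sin_eq_zero (h : IsArchPattern m a b A B f) (hf : ContinuousOn f (Icc 0 π))
    {j : ℕ} (hj : 0 < j) (hjm : j < m) : ∫ x in 0..π, f x * Real.sin ((2 * j : ℕ) * x) = 0 := by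
  have hπ := Real.pi_pos
  have hm : (0 : ℝ) < m := by exact_mod_cast h.pos_count
  have hp : 0 < π / m := by positivity
  have hpπ : π / m ≤ π := div_le_self hπ.le (by exact_mod_cast h.pos_count)
  have hj' : (0 : ℝ) < j := by exact_mod_cast hj
  have hjm' : (j : ℝ) < m := by exact_mod_cast hjm
  have hsin : 0 < Real.sin (j * (π / m)) := by
    refine Real.sin_pos_of_pos_of_lt_pi (by positivity) ?_
    rw [← mul_div_assoc, div_lt_iff₀ hm]
    nlinarith
  set C : ℕ → ℝ := fun k => ∫ y in 0..(π / m),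
    f y * Real.cos (2 * j * y + (2 * k - 1) * (j * (π / m))) with hC
  have hint (k : ℕ) : IntervalIntegrable
      (fun y => f y * Real.cos (2 * j * y + (2 * k - 1) * (j * (π / m))))
      MeasureTheory.volume 0 (π / m) := by
    refine ContinuousOn.intervalIntegrable ((hf.mono ?_).mul (by fun_prop))
    rw [uIcc_of_le hp.le]
    exact Icc_subset_Icc le_rfl hpπ
  have hterm (k : ℕ) : 2 * Real.sin (j * (π / m)) *
      (∫ y in 0..(π / m), f y * Real.sin ((2 * j : ℕ) * (k * (π / m) + y))) =
      C k - C (k + 1) := by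
    rw [hC, ← intervalIntegral.integral_sub (hint k) (hint (k + 1)),
      ← intervalIntegral.integral_const_mul]
    refine intervalIntegral.integral_congr fun y _ => ?_
    rw [← mul_sub, Real.cos_sub_cos]
    have e1 : (2 * j * y + (2 * k - 1) * (j * (π / m)) +
        (2 * j * y + (2 * (k + 1 : ℕ) - 1) * (j * (π / m)))) / 2 =
        (2 * j : ℕ) * (k * (π / m) + y) := by push_cast; ring
    have e2 : (2 * j * y + (2 * k - 1) * (j * (π / m)) -
        (2 * j * y + (2 * (k + 1 : ℕ) - 1) * (j * (π / m)))) / 2 = -(j * (π / m)) := by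
      push_cast; ring
    rw [e1, e2, Real.sin_neg]
    ring
  have hCm : C m = C 0 := by
    rw [hC]
    refine intervalIntegral.integral_congr fun y _ => ?_
    have e : 2 * j * y + (2 * m - 1) * (j * (π / m)) =
        2 * j * y + (2 * (0 : ℕ) - 1) * (j * (π / m)) + j * (2 * π) := by
      push_cast; field_simp; ring
    rw [e, Real.cos_add_nat_mul_two_pi]
  have hmul : 2 * Real.sin (j * (π / m)) * ∫ x in 0..π, f x * Real.sin ((2 * j : ℕ) * x) = 0 := by
    rw [h.integral_mul_eq_sum hf (g := fun x => Real.sin ((2 * j : ℕ) * x)) (by fun_prop),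
      Finset.mul_sum, Finset.sum_congr rfl fun k _ => hterm k, Finset.sum_range_sub', hCm, sub_self]
  exact (mul_eq_zero.1 hmul).resolve_left (by positivity)

/-- Both arches contribute positively to the sine coefficient of frequency `2m`. -/
theorem integral_mul_sin_pos (h : IsArchPattern m a b A B f) (hf : ContinuousOn f (Icc 0 π)) :
    0 < ∫ x in 0..π, f x * Real.sin ((2 * m : ℕ) * x) := by
  have hπ := Real.pi_pos
  have hm : (0 : ℝ) < m := by exact_mod_cast h.pos_count
  have ha := h.pos_left
  have hb := h.pos_right
  have hπa : 0 < π / a := by positivity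
  have hπb : 0 < π / b := by positivity
  have hp : 0 < π / m := by positivity
  have hpπ : π / m ≤ π := div_le_self hπ.le (by exact_mod_cast h.pos_count)
  have hlen := h.length
  have hn : (0 : ℝ) < (2 * m : ℕ) := by exact_mod_cast Nat.mul_pos two_pos h.pos_count
  have hratio := h.freq_ratio_sum
  have hna : 0 < ((2 * m : ℕ) : ℝ) / a := by positivity
  have hnb : 0 < ((2 * m : ℕ) : ℝ) / b := by positivity
  have hper (k : ℕ) (y : ℝ) :
      Real.sin ((2 * m : ℕ) * (k * (π / m) + y)) = Real.sin ((2 * m : ℕ) * y) := by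
    have e : (2 * m : ℕ) * (k * (π / m) + y) = (2 * m : ℕ) * y + k * (2 * π) := by
      push_cast; field_simp; ring
    rw [e, Real.sin_add_nat_mul_two_pi]
  have hint {s t : ℝ} (hs : 0 ≤ s) (hst : s ≤ t) (ht : t ≤ π) :
      IntervalIntegrable (fun y => f y * Real.sin ((2 * m : ℕ) * y)) MeasureTheory.volume s t := by
    refine ContinuousOn.intervalIntegrable ((hf.mono ?_).mul (by fun_prop))
    rw [uIcc_of_le hst]
    exact Icc_subset_Icc hs ht
  have hleft : 0 < ∫ y in 0..(π / a), f y * Real.sin ((2 * m : ℕ) * y) := by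
    have e : ∫ y in 0..(π / a), f y * Real.sin ((2 * m : ℕ) * y) =
        A * ∫ y in 0..(π / a), Real.sin (a * y) * Real.sin ((2 * m : ℕ) * y) := by
      rw [← intervalIntegral.integral_const_mul]
      refine intervalIntegral.integral_congr fun y hy => ?_
      rw [uIcc_of_le hπa.le] at hy
      have h0 := h.left_arch 0 h.pos_count y hy
      rw [Nat.cast_zero, zero_mul, zero_add] at h0
      rw [h0]; ring
    rw [e]
    exact mul_pos h.amp_left_pos (integral_sin_mul_sin_pos ha hn (by push_cast at *; linarith))
  have hright : 0 < ∫ y in (π / a)..(π / m), f y * Real.sin ((2 * m : ℕ) * y) := by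
    have e : ∫ y in (π / a)..(π / m), f y * Real.sin ((2 * m : ℕ) * y) =
        B * ∫ y in 0..(π / b), Real.sin (b * y) * Real.sin ((2 * m : ℕ) * y) := by
      rw [← intervalIntegral.integral_const_mul]
      have e1 : π / a = π / m - π / b := by linarith
      have e2 := intervalIntegral.integral_comp_sub_left (a := 0) (b := π / b)
        (fun y => f y * Real.sin ((2 * m : ℕ) * y)) (π / m)
      rw [sub_zero, ← e1] at e2
      rw [← e2]
      refine intervalIntegral.integral_congr fun y hy => ?_
      rw [uIcc_of_le hπb.le] at hy
      have h0 := h.right_arch 0 h.pos_count y hy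
      rw [Nat.cast_zero, zero_add, one_mul] at h0
      have h1 := hper 1 (-y)
      rw [Nat.cast_one, one_mul, ← sub_eq_add_neg, mul_neg, Real.sin_neg] at h1
      rw [h0, h1]; ring
    rw [e]
    exact mul_pos h.amp_right_pos (integral_sin_mul_sin_pos hb hn (by push_cast at *; linarith))
  rw [h.integral_mul_eq_sum hf (g := fun x => Real.sin ((2 * m : ℕ) * x)) (by fun_prop)]
  simp_rw [hper]
  rw [Finset.sum_const, Finset.card_range, nsmul_eq_mul,
    ← intervalIntegral.integral_add_adjacent_intervals
      (hint le_rfl hπa.le (by linarith)) (hint hπa.le (by linarith) hpπ)]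
  positivity

end IsArchPattern

end Coefficients

/-! ### The Riesz basis property -/

section Conclusion

open Set MeasureTheory
open scoped Real InnerProductSpace

theorem norm_smul_toLp_sub_sineL2_sq_le {g : ℝ → ℝ} (hg : MemLp g 2 Fucik.intervalMeasure) (n : ℕ)
    {D : ℝ} (hD : ∀ x ∈ Icc 0 π, |g x - Real.sin ((n + 1 : ℕ) * x)| ≤ D) :
    ‖√(2 / π) • hg.toLp g - sineL2 n‖ ^ 2 ≤ 2 * D ^ 2 := by
  have hπ := Real.pi_pos
  have hs : MemLp (fun x => Real.sin ((n + 1 : ℕ) * x)) 2 Fucik.intervalMeasure :=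
    memLp_intervalMeasure_of_continuousOn (by fun_prop)
  have he : √(2 / π) • hg.toLp g - sineL2 n = √(2 / π) • (hg.sub hs).toLp _ := by
    rw [MemLp.toLp_sub hg hs, smul_sub]
    rfl
  rw [he, norm_smul, mul_pow, Real.norm_eq_abs, sq_abs, Real.sq_sqrt (by positivity),
    ← real_inner_self_eq_norm_sq, inner_toLp_intervalMeasure]
  have hbound : ∫ x in 0..π, (g - fun x => Real.sin ((n + 1 : ℕ) * x)) x *
      (g - fun x => Real.sin ((n + 1 : ℕ) * x)) x ≤ D ^ 2 * π := by
    refine (le_abs_self _).trans ?_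
    have h := intervalIntegral.norm_integral_le_of_norm_le_const (a := 0) (b := π) (C := D ^ 2)
      (f := fun x => (g - fun x => Real.sin ((n + 1 : ℕ) * x)) x *
        (g - fun x => Real.sin ((n + 1 : ℕ) * x)) x) fun x hx => by
        rw [uIoc_of_le hπ.le] at hx
        rw [← sq, norm_pow, Real.norm_eq_abs]
        gcongr
        exact hD x ⟨hx.1.le, hx.2⟩
    simpa [abs_of_pos hπ] using h
  calc 2 / π * _ ≤ 2 / π * (D ^ 2 * π) := by gcongr
    _ = 2 * D ^ 2 := by field_simp

/-- Triangular `ω`-independence. If the members `ψ k` of a first kind coincide with `e k`, while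
those of the second kind are orthogonal to the `e j` of the first kind and to the `e j` of
the second kind with `j < k`, but not to `e k`, then no nontrivial series `∑ ⟪eₙ, x⟫ ψₙ`
sums to zero. -/
theorem eq_zero_of_hasSum_triangular {H : Type*} [NormedAddCommGroup H] [InnerProductSpace ℝ H]
    (e : HilbertBasis ℕ ℝ H) {ψ : ℕ → H} (P : ℕ → Prop)
    (hfirst : ∀ k, P k → ψ k = e k) (hdiag : ∀ k, ¬ P k → ⟪e k, ψ k⟫_ℝ ≠ 0)
    (htri : ∀ j k, ¬ P j → ¬ P k → j < k → ⟪e j, ψ k⟫_ℝ = 0)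
    (x : H) (hx : HasSum (fun n => ⟪e n, x⟫_ℝ • ψ n) 0) : x = 0 := by
  have hsum (k : ℕ) : HasSum (fun n => ⟪e n, x⟫_ℝ * ⟪e k, ψ n⟫_ℝ) 0 := by
    simpa [real_inner_smul_right] using hx.mapL (innerSL ℝ (e k))
  have horth {j k : ℕ} (hjk : j ≠ k) : ⟪e j, e k⟫_ℝ = 0 := e.orthonormal.inner_eq_zero hjk
  have hsecond : ∀ k, ¬ P k → ⟪e k, x⟫_ℝ = 0 := by
    intro k
    induction k using Nat.strong_induction_on with
    | _ k ih =>
      intro hk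
      have hsingle := hasSum_single (f := fun n => ⟪e n, x⟫_ℝ * ⟪e k, ψ n⟫_ℝ) k fun n hn => by
        by_cases hP : P n
        · rw [hfirst n hP, horth hn.symm, mul_zero]
        · rcases lt_or_gt_of_ne hn with h | h
          · rw [ih n h hP, zero_mul]
          · rw [htri k n hk hP h, mul_zero]
      exact (mul_eq_zero.1 (hsingle.unique (hsum k))).resolve_right (hdiag k hk)
  have hzero : ∀ k, ⟪e k, x⟫_ℝ = 0 := by
    intro k
    by_cases hk : P k
    · have hsingle := hasSum_single (f := fun n => ⟪e n, x⟫_ℝ * ⟪e k, ψ n⟫_ℝ) k fun n hn => by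
        by_cases hP : P n
        · rw [hfirst n hP, horth hn.symm, mul_zero]
        · rw [hsecond n hP, zero_mul]
      have h := hsingle.unique (hsum k)
      rw [hfirst k hk, real_inner_self_eq_norm_sq, e.orthonormal.1 k] at h
      simpa using h
    · exact hsecond k hk
  have h := e.hasSum_repr x
  simp only [e.repr_apply_apply, hzero, zero_smul] at h
  exact h.unique hasSum_zero

end Conclusion

theorem corollary2 (α β : ℕ → ℝ) (F : ℕ → ℝ → ℝ) (hF : Fucik.IsFucikSystem α β F)
    (hodd : ∀ n : ℕ, Odd n → α n = (n : ℝ) ^ 2 ∧ β n = (n : ℝ) ^ 2)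
    (ε c : ℝ) (hε : 0 < ε) (hc : 0 < c)
    (heven : ∀ n : ℕ, 1 ≤ n → Even n →
      max √(α n) √(β n) ≤ (n : ℝ) + √c * (n : ℝ) ^ ((1 - ε) / 2)) :
    Fucik.IsRieszBasisL2 (fun n => F (n + 1)) := by
  have hπ := Real.pi_pos
  have hsin : ∀ n : ℕ, Odd n → ∀ x ∈ Set.Icc 0 Real.pi, F n x = Real.sin (n * x) := by
    intro n hn x hx
    obtain rfl | hn2 : n = 1 ∨ 2 ≤ n := by have := hn.pos; omega
    · simpa using hF.first x hx
    · have h := hF.eigenfunction n hn2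
      rw [(hodd n hn).1, (hodd n hn).2] at h
      exact h.eq_sin (by exact_mod_cast hn.pos) x hx
  have hcont : ∀ n : ℕ, ContinuousOn (F (n + 1)) (Set.Icc 0 Real.pi) := by
    intro n
    cases n with
    | zero => exact Real.continuous_sin.continuousOn.congr hF.first
    | succ n => exact (hF.eigenfunction _ (by omega)).solution.contDiffOn.continuousOn
  have hpat : ∀ m : ℕ, 0 < m →
      ∃ A B, IsArchPattern m √(α (2 * m)) √(β (2 * m)) A B (F (2 * m)) := fun m hm =>
    (hF.eigenfunction _ (by omega)).isArchPattern hm (hF.mem_curve _ (by omega))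
  have hL : ∀ n, MeasureTheory.MemLp (F (n + 1)) 2 Fucik.intervalMeasure := fun n =>
    memLp_intervalMeasure_of_continuousOn (hcont n)
  have hs : 0 < √(2 / Real.pi) := by positivity
  -- the sine functions occurring in the system, normalized
  have hfirst : ∀ k, Odd (k + 1) → √(2 / Real.pi) • (hL k).toLp (F (k + 1)) = sineBasis k := by
    intro k hk
    have h := norm_smul_toLp_sub_sineL2_sq_le (hL k) k (D := 0) fun x hx => by
      simp [hsin (k + 1) hk x hx]
    rw [coe_sineBasis, ← sub_eq_zero, ← norm_eq_zero]
    exact pow_eq_zero_iff two_ne_zero |>.1 (le_antisymm (by simpa using h) (by positivity))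
  have hhalf : ∀ k, ¬ Odd (k + 1) → ∃ m, 0 < m ∧ k + 1 = 2 * m := by
    intro k hk
    obtain ⟨m, hm⟩ := Nat.not_odd_iff_even.1 hk
    exact ⟨m, by omega, by omega⟩
  refine ⟨hL, Fucik.IsRieszBasis.of_smul hs.ne' ?_⟩
  refine isRieszBasis_of_quadratically_close sineBasis ?_
    (eq_zero_of_hasSum_triangular sineBasis (fun k => Odd (k + 1)) hfirst ?_ ?_)
  · have hsummable : Summable fun n : ℕ =>
        2 * (2 + Real.pi) ^ 2 * c * ((n + 1 : ℕ) : ℝ) ^ (-(1 + ε)) :=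
      ((summable_nat_add_iff 1).2
        (Real.summable_nat_rpow.2 (by linarith : -(1 + ε) < -1))).mul_left _
    refine Summable.of_nonneg_of_le (fun n => by positivity) (fun n => ?_) hsummable
    beta_reduce
    by_cases hn : Odd (n + 1)
    · rw [hfirst n hn, sub_self, norm_zero, zero_pow two_ne_zero]
      positivity
    · obtain ⟨m, hm, hnm⟩ := hhalf n hn
      obtain ⟨A, B, h⟩ := hpat m hm
      have hN : (0 : ℝ) < ((n + 1 : ℕ) : ℝ) := by positivity
      have hNm : ((n + 1 : ℕ) : ℝ) = 2 * m := by rw [hnm]; push_cast; ring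
      have hmax := heven (n + 1) (by omega) (Nat.not_odd_iff_even.1 hn)
      set N : ℝ := ((n + 1 : ℕ) : ℝ) with hNdef
      have hD := norm_smul_toLp_sub_sineL2_sq_le (hL n) n
        (D := (2 + Real.pi) * (√c * N ^ ((1 - ε) / 2) / N)) fun x hx => by
          have h1 := h.abs_sub_sin_le hx
          rw [← hnm, ← hNm] at h1
          refine h1.trans ?_
          gcongr
          linarith
      rw [coe_sineBasis]
      refine hD.trans_eq ?_
      have hpow : (N ^ ((1 - ε) / 2)) ^ 2 / N ^ 2 = N ^ (-(1 + ε)) := by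
        rw [← Real.rpow_natCast (N ^ _) 2, ← Real.rpow_mul hN.le, ← Real.rpow_natCast N 2,
          ← Real.rpow_sub hN]
        congr 1
        push_cast
        ring
      rw [mul_pow, div_pow, mul_pow, Real.sq_sqrt hc.le, ← hpow]
      ring
  · intro k hk
    obtain ⟨m, hm, hkm⟩ := hhalf k hk
    obtain ⟨A, B, h⟩ := hpat m hm
    have hk' := hcont k
    rw [hkm] at hk'
    rw [coe_sineBasis, real_inner_smul_right, inner_sineL2_toLp]
    beta_reduce
    rw [hkm]
    have := h.integral_mul_sin_pos hk'
    positivity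
  · intro j k hj hk hjk
    obtain ⟨m, hm, hkm⟩ := hhalf k hk
    obtain ⟨i, hi, hji⟩ := hhalf j hj
    obtain ⟨A, B, h⟩ := hpat m hm
    have hk' := hcont k
    rw [hkm] at hk'
    rw [coe_sineBasis, real_inner_smul_right, inner_sineL2_toLp]
    beta_reduce
    rw [hkm, hji, h.integral_mul_sin_eq_zero hk' hi (by omega), mul_zero, mul_zero]
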